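/- All graphs are finite and simple. A plane triangulation is a graph drawn in the plane without crossings such that every face (including the outer one) is bounded by a triangle. For a planar graph $H$ and an integer $n\ge |V(H)|$, let $\mathrm{ar}_{\mathcal P}(n,H)$ denote the maximum number of colors used in an edge-coloring (not necessarily proper) of a plane triangulation $T$ on $n$ vertices, where $T$ contains a subgraph isomorphic to $H$, such that $T$ contains no rainbow copy of $H$, i.e. no copy of $H$ all of whose edges have different colors. Let $P_k$ denote the path on $k$ vertices. Theorem. Let $k\in\{8,9\}$, let $\varepsilon = k \bmod 2$, let $n\ge k$ be an integer, and let $\varepsilon^*=(n+1+\varepsilon)\bmod 2$. Then $$\mathrm{ar}_{\mathcal P}(n,P_k)\ \ge\ \frac{3n+3\varepsilon-\varepsilon^*-3}{2}.$$ -/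

import Mathlib

namespace PlanarAntiRamsey

/-- `A` is a simple arc in the plane with endpoints `a` and `b`. -/
def IsArc (A : Set (ℝ × ℝ)) (a b : ℝ × ℝ) : Prop :=
  ∃ γ : Path a b, Function.Injective γ ∧ Set.range γ = A

/-- A drawing of the graph `G` in the plane without crossings: vertices are distinct points, every
edge is a simple arc joining its two ends, an arc passes through no vertex other than its ends, and
two different arcs meet only in common ends.  (The values of `arc` off the edge set play no role.)
-/
structure PlaneDrawing {V : Type*} (G : SimpleGraph V) where
  point : V → ℝ × ℝ
  arc : Sym2 V → Set (ℝ × ℝ)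
  point_injective : Function.Injective point
  isArc : ∀ u v : V, G.Adj u v → IsArc (arc s(u, v)) (point u) (point v)
  mem_of_point_mem_arc : ∀ e ∈ G.edgeSet, ∀ w : V, point w ∈ arc e → w ∈ e
  arc_inter_arc : ∀ e ∈ G.edgeSet, ∀ f ∈ G.edgeSet, e ≠ f →
    ∀ p ∈ arc e ∩ arc f, ∃ w : V, w ∈ e ∧ w ∈ f ∧ p = point w

namespace PlaneDrawing

variable {V : Type*} {G : SimpleGraph V} (D : PlaneDrawing G)

/-- The set of all points of the plane that lie on the drawing. -/
def support : Set (ℝ × ℝ) :=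
  Set.range D.point ∪ ⋃ e ∈ G.edgeSet, D.arc e

/-- The faces of a drawing are the connected components of its complement in the plane (the
unbounded one included). -/
def faces : Set (Set (ℝ × ℝ)) :=
  {F | ∃ p ∈ D.supportᶜ, F = connectedComponentIn D.supportᶜ p}

/-- The boundary of the region `F` consists of the three edges of a triangle of the graph. -/
def IsBoundedByTriangle (F : Set (ℝ × ℝ)) : Prop :=
  ∃ a b c : V, G.Adj a b ∧ G.Adj b c ∧ G.Adj c a ∧
    frontier F = D.arc s(a, b) ∪ D.arc s(b, c) ∪ D.arc s(c, a)

end PlaneDrawing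

/-- `T` is (the underlying graph of) a plane triangulation: it can be drawn in the plane without
crossings so that every face, the outer one included, is bounded by a triangle. -/
def IsPlaneTriangulation {V : Type*} (T : SimpleGraph V) : Prop :=
  ∃ D : PlaneDrawing T, ∀ F ∈ D.faces, D.IsBoundedByTriangle F

/-- Under the edge-coloring `c`, the graph `T` contains a rainbow copy of `H`, that is, a copy of
`H` whose edges have pairwise different colors. -/
def HasRainbowCopy {W V : Type*} (H : SimpleGraph W) {T : SimpleGraph V}
    (c : T.edgeSet → ℕ) : Prop :=
  ∃ φ : SimpleGraph.Copy H T,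
    Function.Injective fun e : H.edgeSet => c (φ.toHom.mapEdgeSet e)

/-- The numbers of colors used by edge-colorings, without rainbow copy of `H`, of plane
triangulations on `n` vertices that contain `H` as a subgraph. -/
def colorCounts {W : Type*} (n : ℕ) (H : SimpleGraph W) : Set ℕ :=
  {m | ∃ T : SimpleGraph (Fin n), IsPlaneTriangulation T ∧ H.IsContained T ∧
    ∃ c : T.edgeSet → ℕ, ¬ HasRainbowCopy H c ∧ (Set.range c).ncard = m}

/-- The set over which the maximum is taken is bounded. -/
theorem colorCounts_bddAbove {W : Type*} (n : ℕ) (H : SimpleGraph W) :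
    BddAbove (colorCounts n H) := by
  refine ⟨Nat.card (Sym2 (Fin n)), ?_⟩
  rintro m ⟨T, -, -, c, -, rfl⟩
  calc (Set.range c).ncard ≤ Nat.card T.edgeSet := by
        rw [← Set.image_univ, ← Set.ncard_univ]
        exact Set.ncard_image_le Set.finite_univ
    _ ≤ Nat.card (Sym2 (Fin n)) := Nat.card_le_card_of_injective _ Subtype.val_injective

/-- The planar anti-Ramsey number of `H`: the maximum number of colors in an edge-coloring, without
rainbow copy of `H`, of a plane triangulation on `n` vertices that contains `H` as a subgraph. -/
noncomputable def planarAntiRamsey {W : Type*} (n : ℕ) (H : SimpleGraph W) : ℕ :=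
  sSup (colorCounts n H)

end PlanarAntiRamsey

namespace PlanarAntiRamsey

/-! The witness is the join of an edge 01 with a path 2, …, n-1. Every edge at vertex 0 gets a
private color, and so does every edge of the matching 12, 34, 56, …; all remaining edges share color
0. For k = 9 the edge between n-2 and n-1 is made private as well, which is new only for even n.
This uses n + ⌊(n-1)/2⌋ colors for k = 8 and n + ⌊n/2⌋ for k = 9 (`mem_range_fanColoring`).

A rainbow path meets vertex 0 at most once and uses color 0 at most once. Deleting that vertex and
that edge leaves at most three pieces, all of whose edges are linked pairs
(`exists_linked_of_hasRainbowCopy`). For k = 8, at least seven vertices in three pieces force a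
piece with three vertices, impossible in a matching. For k = 9 only one linked component can have
three vertices, so the pieces cover at most 2 + 2 + 3 = 7 vertices, while at least eight remain.

That the double fan is a plane triangulation is checked on an explicit straight-line drawing. Each
expected face is an open connected set that avoids the drawing and has its frontier in it, hence is
a full component of the complement (`connectedComponentIn_compl_eq`); these sets exhaust the
complement (`mem_region_of_notMem_support`). -/

/-! ### Triangles in the plane via signed areas. -/

/-- Twice the signed area of the triangle `a`, `b`, `p`. -/
def orient (a b p : ℝ × ℝ) : ℝ :=
  (b.1 - a.1) * (p.2 - a.2) - (b.2 - a.2) * (p.1 - a.1)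

/-- The interior of a positively oriented triangle. -/
def openTriangle (a b c : ℝ × ℝ) : Set (ℝ × ℝ) :=
  {p | 0 < orient a b p ∧ 0 < orient b c p ∧ 0 < orient c a p}

/-- A positively oriented triangle together with its boundary. -/
def closedTriangle (a b c : ℝ × ℝ) : Set (ℝ × ℝ) :=
  {p | 0 ≤ orient a b p ∧ 0 ≤ orient b c p ∧ 0 ≤ orient c a p}

theorem continuous_orient (a b : ℝ × ℝ) : Continuous (orient a b) := by
  unfold orient; fun_prop

theorem orient_combo (a b p q : ℝ × ℝ) {s t : ℝ} (h : s + t = 1) :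
    orient a b (s • p + t • q) = s * orient a b p + t * orient a b q := by
  obtain rfl : s = 1 - t := by linarith
  simp only [orient, Prod.fst_add, Prod.snd_add, Prod.smul_fst, Prod.smul_snd, smul_eq_mul]
  ring

theorem orient_rotate (a b c : ℝ × ℝ) : orient b c a = orient a b c := by
  unfold orient; ring

theorem orient_add_orient_add_orient (a b c p : ℝ × ℝ) :
    orient a b p + orient b c p + orient c a p = orient a b c := by
  unfold orient; ring

theorem convex_orient_pos (a b : ℝ × ℝ) : Convex ℝ {p | 0 < orient a b p} := by
  intro p hp q hq s t hs ht hst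
  simp only [Set.mem_ofPred_eq] at hp hq ⊢
  rw [orient_combo a b p q hst]
  rcases hs.eq_or_lt with rfl | hs
  · obtain rfl : t = 1 := by linarith
    linarith
  · have := mul_pos hs hp
    have := mul_nonneg ht hq.le
    linarith

theorem convex_orient_neg (a b : ℝ × ℝ) : Convex ℝ {p | orient a b p < 0} := by
  have h : {p | orient a b p < 0} = {p | 0 < orient b a p} := by
    ext p
    have : orient b a p = - orient a b p := by unfold orient; ring
    simp [this]
  exact h ▸ convex_orient_pos b a

theorem isOpen_orient_pos (a b : ℝ × ℝ) : IsOpen {p | 0 < orient a b p} :=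
  isOpen_lt continuous_const (continuous_orient a b)

theorem isClosed_orient_nonneg (a b : ℝ × ℝ) : IsClosed {p | 0 ≤ orient a b p} :=
  isClosed_le continuous_const (continuous_orient a b)

theorem isOpen_openTriangle (a b c : ℝ × ℝ) : IsOpen (openTriangle a b c) :=
  (isOpen_orient_pos a b).inter ((isOpen_orient_pos b c).inter (isOpen_orient_pos c a))

theorem isClosed_closedTriangle (a b c : ℝ × ℝ) : IsClosed (closedTriangle a b c) :=
  (isClosed_orient_nonneg a b).inter
    ((isClosed_orient_nonneg b c).inter (isClosed_orient_nonneg c a))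

theorem convex_openTriangle (a b c : ℝ × ℝ) : Convex ℝ (openTriangle a b c) :=
  (convex_orient_pos a b).inter ((convex_orient_pos b c).inter (convex_orient_pos c a))

theorem openTriangle_subset_closedTriangle (a b c : ℝ × ℝ) :
    openTriangle a b c ⊆ closedTriangle a b c :=
  fun _ ⟨h₁, h₂, h₃⟩ => ⟨h₁.le, h₂.le, h₃.le⟩

/-- The point with prescribed areal coordinates. -/
theorem exists_orient_eq (a b c : ℝ × ℝ) {x y z : ℝ}
    (hxyz : x + y + z = 1) :
    ∃ p, orient a b p = z * orient a b c ∧ orient b c p = x * orient a b c ∧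
      orient c a p = y * orient a b c := by
  obtain rfl : x = 1 - y - z := by linarith
  refine ⟨(1 - y - z) • a + y • b + z • c, ?_, ?_, ?_⟩ <;>
  · simp only [orient, Prod.fst_add, Prod.snd_add, Prod.smul_fst, Prod.smul_snd, smul_eq_mul]
    ring

theorem openTriangle_nonempty {a b c : ℝ × ℝ} (h : 0 < orient a b c) :
    (openTriangle a b c).Nonempty := by
  obtain ⟨p, h₁, h₂, h₃⟩ := exists_orient_eq a b c (x := 1 / 3) (y := 1 / 3) (z := 1 / 3)
    (by norm_num)
  exact ⟨p, by rw [h₁]; positivity, by rw [h₂]; positivity, by rw [h₃]; positivity⟩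

/-- Sliding a point of the closed triangle slightly towards a fixed interior point makes all three
signed areas positive. -/
theorem closure_openTriangle {a b c : ℝ × ℝ} (h : 0 < orient a b c) :
    closure (openTriangle a b c) = closedTriangle a b c := by
  refine (closure_minimal (openTriangle_subset_closedTriangle a b c)
    (isClosed_closedTriangle a b c)).antisymm fun p ⟨h₁, h₂, h₃⟩ => ?_
  obtain ⟨g, hg₁, hg₂, hg₃⟩ := openTriangle_nonempty h
  have hlim : Filter.Tendsto (fun t : ℝ => (1 - t) • p + t • g) (nhdsWithin 0 (Set.Ioo 0 1))
      (nhds p) := by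
    have : Continuous fun t : ℝ => (1 - t) • p + t • g := by fun_prop
    simpa using (this.tendsto 0).mono_left nhdsWithin_le_nhds
  have : (nhdsWithin (0 : ℝ) (Set.Ioo 0 1)).NeBot := by
    rw [← mem_closure_iff_nhdsWithin_neBot, closure_Ioo (by norm_num)]
    simp
  refine mem_closure_of_tendsto hlim ?_
  filter_upwards [self_mem_nhdsWithin] with t ht
  have key : ∀ u v : ℝ × ℝ, 0 ≤ orient u v p → 0 < orient u v g →
      0 < orient u v ((1 - t) • p + t • g) := fun u v hp hg => by
    rw [orient_combo u v p g (by ring)]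
    have := mul_pos ht.1 hg
    have := mul_nonneg (sub_nonneg.2 ht.2.le) hp
    linarith
  exact ⟨key _ _ h₁ hg₁, key _ _ h₂ hg₂, key _ _ h₃ hg₃⟩

theorem interior_closedTriangle {a b c : ℝ × ℝ} (h : 0 < orient a b c) :
    interior (closedTriangle a b c) = openTriangle a b c := by
  have hi := (isOpen_openTriangle a b c).interior_eq
  rw [← closure_openTriangle h,
    (convex_openTriangle a b c).interior_closure_eq_interior_of_nonempty_interior
    (hi.symm ▸ openTriangle_nonempty h), hi]

theorem segment_subset_closedTriangle {a b c : ℝ × ℝ} (h : 0 < orient a b c) {p : ℝ × ℝ}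
    (hp : p ∈ segment ℝ a b) : p ∈ closedTriangle a b c ∧ orient a b p = 0 := by
  obtain ⟨s, t, hs, ht, hst, rfl⟩ := hp
  have h₁ : orient a b (s • a + t • b) = 0 := by
    rw [orient_combo a b a b hst]; unfold orient; ring
  refine ⟨⟨h₁.ge, ?_, ?_⟩, h₁⟩
  · rw [orient_combo b c a b hst, orient_rotate, show orient b c b = 0 by unfold orient; ring]
    positivity
  · rw [orient_combo c a a b hst, orient_rotate b c a, orient_rotate a b c,
      show orient c a a = 0 by unfold orient; ring]
    positivity

theorem mem_segment_of_orient_eq_zero {a b c : ℝ × ℝ} (h : 0 < orient a b c) {p : ℝ × ℝ}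
    (hp : p ∈ closedTriangle a b c) (h0 : orient a b p = 0) : p ∈ segment ℝ a b := by
  obtain ⟨-, h₂, h₃⟩ := hp
  have hsum := orient_add_orient_add_orient a b c p
  refine ⟨orient b c p / orient a b c, orient c a p / orient a b c, by positivity, by positivity,
    by field_simp; linarith, ?_⟩
  have hne := h.ne'
  have e1 : orient b c p * a.1 + orient c a p * b.1 + orient a b p * c.1 = orient a b c * p.1 := by
    unfold orient; ring
  have e2 : orient b c p * a.2 + orient c a p * b.2 + orient a b p * c.2 = orient a b c * p.2 := by
    unfold orient; ring
  ext
  · simp only [Prod.fst_add, Prod.smul_fst, smul_eq_mul]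
    field_simp; rw [h0] at e1; linarith
  · simp only [Prod.snd_add, Prod.smul_snd, smul_eq_mul]
    field_simp; rw [h0] at e2; linarith

theorem closedTriangle_rotate (a b c : ℝ × ℝ) : closedTriangle b c a = closedTriangle a b c := by
  ext p; simp only [closedTriangle, Set.mem_ofPred_eq]; tauto

theorem closedTriangle_diff_openTriangle {a b c : ℝ × ℝ} (h : 0 < orient a b c) :
    closedTriangle a b c \ openTriangle a b c =
      segment ℝ a b ∪ segment ℝ b c ∪ segment ℝ c a := by
  have h' : 0 < orient b c a := by rwa [orient_rotate]
  have h'' : 0 < orient c a b := by rwa [orient_rotate]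
  have r' := closedTriangle_rotate a b c
  have r'' := closedTriangle_rotate b c a
  ext p
  constructor
  · rintro ⟨hp, hn⟩
    by_cases h₁ : orient a b p = 0
    · exact .inl (.inl (mem_segment_of_orient_eq_zero h hp h₁))
    by_cases h₂ : orient b c p = 0
    · exact .inl (.inr (mem_segment_of_orient_eq_zero h' (r' ▸ hp) h₂))
    by_cases h₃ : orient c a p = 0
    · exact .inr (mem_segment_of_orient_eq_zero h'' (r'' ▸ r' ▸ hp) h₃)
    exact absurd ⟨hp.1.lt_of_ne' h₁, hp.2.1.lt_of_ne' h₂, hp.2.2.lt_of_ne' h₃⟩ hn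
  · rintro ((hp | hp) | hp)
    · have := segment_subset_closedTriangle h hp
      exact ⟨this.1, fun hn => hn.1.ne' this.2⟩
    · have := segment_subset_closedTriangle h' hp
      exact ⟨r' ▸ this.1, fun hn => hn.2.1.ne' this.2⟩
    · have := segment_subset_closedTriangle h'' hp
      exact ⟨r' ▸ r'' ▸ this.1, fun hn => hn.2.2.ne' this.2⟩

theorem frontier_openTriangle {a b c : ℝ × ℝ} (h : 0 < orient a b c) :
    frontier (openTriangle a b c) = segment ℝ a b ∪ segment ℝ b c ∪ segment ℝ c a := by
  rw [(isOpen_openTriangle a b c).frontier_eq, closure_openTriangle h,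
    closedTriangle_diff_openTriangle h]

theorem frontier_compl_closedTriangle {a b c : ℝ × ℝ} (h : 0 < orient a b c) :
    frontier (closedTriangle a b c)ᶜ = segment ℝ a b ∪ segment ℝ b c ∪ segment ℝ c a := by
  rw [frontier_compl, (isClosed_closedTriangle a b c).frontier_eq, interior_closedTriangle h,
    closedTriangle_diff_openTriangle h]

/-- The complement is a union of three open half-planes, and successive ones overlap. -/
theorem isPreconnected_compl_closedTriangle {a b c : ℝ × ℝ} (h : 0 < orient a b c) :
    IsPreconnected (closedTriangle a b c)ᶜ := by
  have heq : (closedTriangle a b c)ᶜ =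
      {p | orient a b p < 0} ∪ {p | orient b c p < 0} ∪ {p | orient c a p < 0} := by
    ext p
    simp only [closedTriangle, Set.mem_compl_iff, Set.mem_ofPred_eq, Set.mem_union, ← not_le]
    tauto
  -- Two negative areal coordinates put a point beyond two sides at once: `p` links the half-planes
  -- at ab and bc, `q` those at bc and ca.
  obtain ⟨p, hp₁, hp₂, -⟩ := exists_orient_eq a b c (x := -1) (y := 3) (z := -1) (by norm_num)
  obtain ⟨q, -, hq₂, hq₃⟩ := exists_orient_eq a b c (x := -1) (y := -1) (z := 3) (by norm_num)
  rw [heq]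
  refine IsPreconnected.union q (.inr ?_) ?_ (IsPreconnected.union p ?_ ?_
    (convex_orient_neg a b).isPreconnected (convex_orient_neg b c).isPreconnected)
    (convex_orient_neg c a).isPreconnected <;>
  · simp only [Set.mem_ofPred_eq]
    linarith

/-! ### Components of a complement, and segments as arcs. -/

/-- A connected open set avoiding `S` whose boundary lies in `S` is a component of `Sᶜ`. -/
theorem connectedComponentIn_compl_eq {X : Type*} [TopologicalSpace X] {S U : Set X} {p : X}
    (hU : IsOpen U) (hc : IsPreconnected U) (hS : Disjoint U S) (hf : frontier U ⊆ S)
    (hp : p ∈ U) : connectedComponentIn Sᶜ p = U := by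
  have hUS : U ⊆ Sᶜ := hS.subset_compl_right
  refine Set.Subset.antisymm ?_ (hc.subset_connectedComponentIn hp hUS)
  have hsub : connectedComponentIn Sᶜ p ⊆ U ∪ (closure U)ᶜ := fun q hq => by
    by_cases hqU : q ∈ U
    · exact .inl hqU
    · refine .inr fun hcl => connectedComponentIn_subset _ _ hq (hf ?_)
      rw [hU.frontier_eq]
      exact ⟨hcl, hqU⟩
  exact isPreconnected_connectedComponentIn.subset_left_of_subset_union hU
    isClosed_closure.isOpen_compl (disjoint_compl_right.mono_left subset_closure) hsub
    ⟨p, mem_connectedComponentIn (hUS hp), hp⟩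

theorem isArc_segment {a b : ℝ × ℝ} (h : a ≠ b) : IsArc (segment ℝ a b) a b := by
  refine ⟨⟨⟨fun t => AffineMap.lineMap a b (t : ℝ), 
    AffineMap.lineMap_continuous.comp continuous_subtype_val⟩, by simp, by simp⟩, ?_, ?_⟩
  · intro s t hst
    exact Subtype.ext (AffineMap.lineMap_injective ℝ h hst)
  · rw [segment_eq_image_lineMap]
    ext p
    simp [Set.mem_image]

/-! ### The double fan and its coordinates. -/

/-- The join of an edge `01` with a path `2, 3, …, n - 1`. -/
def doubleFan (n : ℕ) : SimpleGraph (Fin n) where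
  Adj i j := i ≠ j ∧ (i.1 ≤ 1 ∨ j.1 ≤ 1 ∨ i.1 + 1 = j.1 ∨ j.1 + 1 = i.1)
  symm := ⟨fun _ _ h => ⟨h.1.symm, by tauto⟩⟩
  loopless := ⟨fun _ h => h.1 rfl⟩

theorem doubleFan_adj {n : ℕ} {i j : Fin n} : (doubleFan n).Adj i j ↔
    i ≠ j ∧ (i.1 ≤ 1 ∨ j.1 ≤ 1 ∨ i.1 + 1 = j.1 ∨ j.1 + 1 = i.1) := Iff.rfl

/-- The two hubs of the double fan lie on the horizontal axis, its path on the vertical axis. -/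
noncomputable def fanPoint (i : ℕ) : ℝ × ℝ :=
  if i = 0 then (-1, 0) else if i = 1 then (1, 0) else (0, (i : ℝ) - 1)

theorem fanPoint_zero : fanPoint 0 = (-1, 0) := rfl

theorem fanPoint_one : fanPoint 1 = (1, 0) := rfl

theorem fanPoint_of_two_le {i : ℕ} (hi : 2 ≤ i) : fanPoint i = (0, (i : ℝ) - 1) := by
  rw [fanPoint, if_neg (by omega), if_neg (by omega)]

theorem fanPoint_injective : Function.Injective fanPoint := by
  intro i j h
  unfold fanPoint at h
  split_ifs at h <;> simp only [Prod.mk.injEq] at h <;> first | omega | skip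
  all_goals norm_num at h
  exact h

/-- The straight edge between two vertices of the double fan. -/
noncomputable def fanArc {n : ℕ} (e : Sym2 (Fin n)) : Set (ℝ × ℝ) :=
  Sym2.lift ⟨fun i j : Fin n => segment ℝ (fanPoint i) (fanPoint j), fun _ _ => segment_symm _ _ _⟩ e

theorem fanArc_mk {n : ℕ} (i j : Fin n) :
    fanArc s(i, j) = segment ℝ (fanPoint i) (fanPoint j) := rfl

theorem mem_segment_hubs {p : ℝ × ℝ} :
    p ∈ segment ℝ (fanPoint 0) (fanPoint 1) ↔ p.2 = 0 ∧ |p.1| ≤ 1 := by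
  rw [fanPoint_zero, fanPoint_one, abs_le]
  constructor
  · rintro ⟨s, t, hs, ht, hst, rfl⟩
    simp only [Prod.fst_add, Prod.snd_add, Prod.smul_fst, Prod.smul_snd, smul_eq_mul]
    refine ⟨by ring, by linarith, by linarith⟩
  · rintro ⟨h0, h1, h2⟩
    refine ⟨(1 - p.1) / 2, (1 + p.1) / 2, by linarith, by linarith, by ring, ?_⟩
    ext
    · simp only [Prod.fst_add, Prod.smul_fst, smul_eq_mul]; ring
    · simp [h0]

theorem mem_segment_left {j : ℕ} (hj : 2 ≤ j) {p : ℝ × ℝ} :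
    p ∈ segment ℝ (fanPoint 0) (fanPoint j) ↔
      -1 ≤ p.1 ∧ p.1 ≤ 0 ∧ p.2 = ((j : ℝ) - 1) * (1 + p.1) := by
  rw [fanPoint_zero, fanPoint_of_two_le hj]
  constructor
  · rintro ⟨s, t, hs, ht, hst, rfl⟩
    simp only [Prod.fst_add, Prod.snd_add, Prod.smul_fst, Prod.smul_snd, smul_eq_mul]
    refine ⟨by linarith, by linarith, ?_⟩
    obtain rfl : s = 1 - t := by linarith
    ring
  · rintro ⟨h1, h2, h3⟩
    refine ⟨-p.1, 1 + p.1, by linarith, by linarith, by ring, ?_⟩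
    ext
    · simp
    · simp [h3, mul_comm]

theorem mem_segment_right {j : ℕ} (hj : 2 ≤ j) {p : ℝ × ℝ} :
    p ∈ segment ℝ (fanPoint 1) (fanPoint j) ↔
      0 ≤ p.1 ∧ p.1 ≤ 1 ∧ p.2 = ((j : ℝ) - 1) * (1 - p.1) := by
  rw [fanPoint_one, fanPoint_of_two_le hj]
  constructor
  · rintro ⟨s, t, hs, ht, hst, rfl⟩
    simp only [Prod.fst_add, Prod.snd_add, Prod.smul_fst, Prod.smul_snd, smul_eq_mul]
    refine ⟨by linarith, by linarith, ?_⟩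
    obtain rfl : s = 1 - t := by linarith
    ring
  · rintro ⟨h1, h2, h3⟩
    refine ⟨p.1, 1 - p.1, by linarith, by linarith, by ring, ?_⟩
    ext
    · simp
    · simp [h3, mul_comm]

theorem mem_segment_axis {i : ℕ} (hi : 2 ≤ i) {p : ℝ × ℝ} :
    p ∈ segment ℝ (fanPoint i) (fanPoint (i + 1)) ↔
      p.1 = 0 ∧ (i : ℝ) - 1 ≤ p.2 ∧ p.2 ≤ i := by
  rw [fanPoint_of_two_le hi, fanPoint_of_two_le (by omega)]
  push_cast
  constructor
  · rintro ⟨s, t, hs, ht, hst, rfl⟩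
    simp only [Prod.fst_add, Prod.snd_add, Prod.smul_fst, Prod.smul_snd, smul_eq_mul]
    obtain rfl : s = 1 - t := by linarith
    refine ⟨by ring, by linarith, by linarith⟩
  · rintro ⟨h1, h2, h3⟩
    refine ⟨i - p.2, p.2 - (i - 1), by linarith, by linarith, by ring, ?_⟩
    ext
    · simp [h1]
    · simp only [Prod.snd_add, Prod.smul_snd, smul_eq_mul]; ring

/-! ### Straight edges meet only in common ends. -/

/-- The position of a point on an edge of the double fan, for the four kinds of edges. -/
theorem fanArc_cases {n : ℕ} {e : Sym2 (Fin n)} (he : e ∈ (doubleFan n).edgeSet) {p : ℝ × ℝ}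
    (hp : p ∈ fanArc e) :
    (∃ i j : Fin n, e = s(i, j) ∧ i.1 = 0 ∧ j.1 = 1 ∧ p.2 = 0 ∧ |p.1| ≤ 1) ∨
    (∃ i j : Fin n, e = s(i, j) ∧ i.1 = 0 ∧ 2 ≤ j.1 ∧
      -1 ≤ p.1 ∧ p.1 ≤ 0 ∧ p.2 = ((j : ℝ) - 1) * (1 + p.1)) ∨
    (∃ i j : Fin n, e = s(i, j) ∧ i.1 = 1 ∧ 2 ≤ j.1 ∧
      0 ≤ p.1 ∧ p.1 ≤ 1 ∧ p.2 = ((j : ℝ) - 1) * (1 - p.1)) ∨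
    (∃ i j : Fin n, e = s(i, j) ∧ 2 ≤ i.1 ∧ j.1 = i.1 + 1 ∧
      p.1 = 0 ∧ (i : ℝ) - 1 ≤ p.2 ∧ p.2 ≤ i) := by
  induction e using Sym2.inductionOn with
  | hf i j =>
    wlog hij : i < j generalizing i j
    · have hji := (not_lt.1 hij).lt_of_ne' he.1
      rw [Sym2.eq_swap] at he hp ⊢
      exact this j i he hp hji
    rw [SimpleGraph.mem_edgeSet, doubleFan_adj] at he
    rw [fanArc_mk] at hp
    have hij : i.1 < j.1 := hij
    rcases Nat.lt_or_ge j.1 2 with hj | hj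
    · have h0 : i.1 = 0 := by omega
      have h1 : j.1 = 1 := by omega
      rw [h0, h1, mem_segment_hubs] at hp
      exact .inl ⟨i, j, rfl, h0, h1, hp⟩
    rcases Nat.lt_trichotomy i.1 1 with hi | hi | hi
    · have h0 : i.1 = 0 := by omega
      rw [h0, mem_segment_left hj] at hp
      exact .inr (.inl ⟨i, j, rfl, h0, hj, hp⟩)
    · rw [hi, mem_segment_right hj] at hp
      exact .inr (.inr (.inl ⟨i, j, rfl, hi, hj, hp⟩))
    · have h1 : j.1 = i.1 + 1 := by omega
      rw [h1, mem_segment_axis hi] at hp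
      exact .inr (.inr (.inr ⟨i, j, rfl, hi, h1, hp⟩))

theorem mem_of_fanPoint_mem_fanArc {n : ℕ} {e : Sym2 (Fin n)} (he : e ∈ (doubleFan n).edgeSet)
    {w : Fin n} (hw : fanPoint w ∈ fanArc e) : w ∈ e := by
  rcases fanArc_cases he hw with ⟨i, j, rfl, hi, hj, h⟩ | ⟨i, j, rfl, hi, hj, h⟩ |
    ⟨i, j, rfl, hi, hj, h⟩ | ⟨i, j, rfl, hi, hj, h⟩ <;>
  rw [Sym2.mem_iff, Fin.ext_iff, Fin.ext_iff] <;>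
  rcases (by omega : w.1 = 0 ∨ w.1 = 1 ∨ 2 ≤ w.1) with hw | hw | hw <;>
  first
  | omega
  | (rw [hw, fanPoint_zero] at h; norm_num at h)
  | (rw [hw, fanPoint_one] at h; norm_num at h)
  | skip
  all_goals rw [fanPoint_of_two_le hw] at h; norm_num at h
  · have : (2 : ℝ) ≤ w.1 := by exact_mod_cast hw
    linarith
  · exact .inr h
  · exact .inr h
  · have h1 : i.1 ≤ w.1 := by exact_mod_cast h.1
    have h2 : w.1 ≤ i.1 + 1 := by exact_mod_cast h.2
    omega

theorem exists_common_end {n : ℕ} {e f : Sym2 (Fin n)} (he : e ∈ (doubleFan n).edgeSet)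
    (hf : f ∈ (doubleFan n).edgeSet) (hef : e ≠ f) {p : ℝ × ℝ} (hp : p ∈ fanArc e)
    (hp' : p ∈ fanArc f) : ∃ w : Fin n, w ∈ e ∧ w ∈ f ∧ p = fanPoint w := by
  -- Ends of `e` and `f` are matched through their numerical label, so each of the sixteen pairs of
  -- edge kinds reduces to an equality of labels and the coordinates of `p`.
  have common : ∀ {a b : Fin n} {k : ℕ}, a.1 = k → b.1 = k → a ∈ e → b ∈ f → p = fanPoint k →
      ∃ w : Fin n, w ∈ e ∧ w ∈ f ∧ p = fanPoint w := by
    rintro a b _ rfl hab ha hb h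
    exact ⟨a, ha, Fin.ext hab ▸ hb, h⟩
  have zero : p.1 = -1 → p.2 = 0 → p = fanPoint 0 := fun h h' => Prod.ext h h'
  have one : p.1 = 1 → p.2 = 0 → p = fanPoint 1 := fun h h' => Prod.ext h h'
  have axis : ∀ {k : ℕ}, 2 ≤ k → p.1 = 0 → p.2 = (k : ℝ) - 1 → p = fanPoint k :=
    fun hk h h' => by rw [fanPoint_of_two_le hk]; exact Prod.ext h h'
  have height : ∀ {j : Fin n}, 2 ≤ j.1 → (1 : ℝ) ≤ (j : ℝ) - 1 := fun {j} hj => by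
    have : (2 : ℝ) ≤ j.1 := by exact_mod_cast hj
    linarith
  have left : ∀ {j : Fin n}, 2 ≤ j.1 → p.2 = 0 → p.2 = ((j : ℝ) - 1) * (1 + p.1) →
      p = fanPoint 0 := fun {j} hj h h' => zero (by nlinarith [height hj]) h
  have right : ∀ {j : Fin n}, 2 ≤ j.1 → p.2 = 0 → p.2 = ((j : ℝ) - 1) * (1 - p.1) →
      p = fanPoint 1 := fun {j} hj h h' => one (by nlinarith [height hj]) h
  have left_right : ∀ {j j' : Fin n}, 2 ≤ j.1 → p.1 ≤ 0 → 0 ≤ p.1 →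
      p.2 = ((j : ℝ) - 1) * (1 + p.1) → p.2 = ((j' : ℝ) - 1) * (1 - p.1) →
      p = fanPoint j ∧ j'.1 = j.1 := fun {j j'} hj h₁ h₂ h h' => by
    have h0 : p.1 = 0 := le_antisymm h₁ h₂
    rw [h0] at h h'
    refine ⟨axis hj h0 (by linarith), ?_⟩
    have : (j' : ℝ) = j := by linarith
    exact_mod_cast this
  have on_axis : ∀ {j i : Fin n}, 2 ≤ j.1 → p.1 = 0 → p.2 = (j : ℝ) - 1 → (i : ℝ) - 1 ≤ p.2 →
      p.2 ≤ i → p = fanPoint j ∧ (i.1 = j.1 ∨ i.1 + 1 = j.1) := fun {j i} hj h0 h h₁ h₂ => by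
    refine ⟨axis hj h0 h, ?_⟩
    have h₁ : (i : ℝ) ≤ j := by linarith
    have h₂ : (j : ℝ) ≤ i + 1 := by linarith
    have h₁ : i.1 ≤ j.1 := by exact_mod_cast h₁
    have h₂ : j.1 ≤ i.1 + 1 := by exact_mod_cast h₂
    omega
  have above : ∀ {i : Fin n}, 2 ≤ i.1 → p.2 = 0 → ¬ (i : ℝ) - 1 ≤ p.2 := fun {i} hi h h' => by
    linarith [height hi]
  have stacked : ∀ {i i' : Fin n}, 2 ≤ i.1 → i.1 < i'.1 → p.1 = 0 → p.2 ≤ i →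
      (i' : ℝ) - 1 ≤ p.2 → p = fanPoint (i.1 + 1) ∧ i'.1 = i.1 + 1 :=
    fun {i i'} hi hlt h0 h h' => by
      have h₁ : (i.1 : ℝ) + 1 ≤ i'.1 := by exact_mod_cast hlt
      have h₂ : (i'.1 : ℝ) ≤ i.1 + 1 := by linarith
      refine ⟨axis (by omega) h0 (by push_cast; linarith), le_antisymm ?_ hlt⟩
      exact_mod_cast h₂
  rcases fanArc_cases he hp with ⟨i, j, rfl, hi, hj, h⟩ | ⟨i, j, rfl, hi, hj, h⟩ |
    ⟨i, j, rfl, hi, hj, h⟩ | ⟨i, j, rfl, hi, hj, h⟩ <;>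
  rcases fanArc_cases hf hp' with ⟨i', j', rfl, hi', hj', h'⟩ | ⟨i', j', rfl, hi', hj', h'⟩ |
    ⟨i', j', rfl, hi', hj', h'⟩ | ⟨i', j', rfl, hi', hj', h'⟩
  · exact absurd (by rw [Fin.ext (hi.trans hi'.symm), Fin.ext (hj.trans hj'.symm)]) hef
  · exact common hi hi' (by simp) (by simp) (left hj' h.1 h'.2.2)
  · exact common hj hi' (by simp) (by simp) (right hj' h.1 h'.2.2)
  · exact absurd h'.2.1 (above hi' h.1)
  · exact common hi hi' (by simp) (by simp) (left hj h'.1 h.2.2)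
  -- Two edges from the same hub have different slopes, so they meet only at the hub.
  · have hne : (j : ℝ) - j' ≠ 0 := fun h0 => hef (by
      rw [Fin.ext (hi.trans hi'.symm), Fin.ext (by exact_mod_cast sub_eq_zero.1 h0 : j.1 = j'.1)])
    have h0 : 1 + p.1 = 0 := by
      refine (mul_eq_zero.1 (?_ : ((j : ℝ) - j') * (1 + p.1) = 0)).resolve_left hne
      linarith [h.2.2, h'.2.2]
    exact common hi hi' (by simp) (by simp) (zero (by linarith) (by rw [h.2.2, h0, mul_zero]))
  · have := left_right hj h.2.1 h'.1 h.2.2 h'.2.2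
    exact common rfl this.2 (by simp) (by simp) this.1
  · obtain ⟨hpj, hw⟩ := on_axis hj h'.1 (by rw [h.2.2, h'.1]; ring) h'.2.1 h'.2.2
    rcases hw with hw | hw
    · exact common rfl hw (by simp) (by simp) hpj
    · exact common rfl (hj'.trans hw) (by simp) (by simp) hpj
  · exact common hi hj' (by simp) (by simp) (right hj h'.1 h.2.2)
  · have := left_right hj' h'.2.1 h.1 h'.2.2 h.2.2
    exact common this.2 rfl (by simp) (by simp) this.1
  · have hne : (j : ℝ) - j' ≠ 0 := fun h0 => hef (by
      rw [Fin.ext (hi.trans hi'.symm), Fin.ext (by exact_mod_cast sub_eq_zero.1 h0 : j.1 = j'.1)])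
    have h0 : 1 - p.1 = 0 := by
      refine (mul_eq_zero.1 (?_ : ((j : ℝ) - j') * (1 - p.1) = 0)).resolve_left hne
      linarith [h.2.2, h'.2.2]
    exact common hi hi' (by simp) (by simp) (one (by linarith) (by rw [h.2.2, h0, mul_zero]))
  · obtain ⟨hpj, hw⟩ := on_axis hj h'.1 (by rw [h.2.2, h'.1]; ring) h'.2.1 h'.2.2
    rcases hw with hw | hw
    · exact common rfl hw (by simp) (by simp) hpj
    · exact common rfl (hj'.trans hw) (by simp) (by simp) hpj
  · exact absurd h.2.1 (above hi h'.1)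
  · obtain ⟨hpj, hw⟩ := on_axis hj' h.1 (by rw [h'.2.2, h.1]; ring) h.2.1 h.2.2
    rcases hw with hw | hw
    · exact common hw rfl (by simp) (by simp) hpj
    · exact common (hj.trans hw) rfl (by simp) (by simp) hpj
  · obtain ⟨hpj, hw⟩ := on_axis hj' h.1 (by rw [h'.2.2, h.1]; ring) h.2.1 h.2.2
    rcases hw with hw | hw
    · exact common hw rfl (by simp) (by simp) hpj
    · exact common (hj.trans hw) rfl (by simp) (by simp) hpj
  · rcases Nat.lt_trichotomy i.1 i'.1 with hlt | heq | hlt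
    · have := stacked hi hlt h.1 h.2.2 h'.2.1
      exact common hj this.2 (by simp) (by simp) this.1
    · exact absurd (by rw [Fin.ext heq, Fin.ext (by omega : j.1 = j'.1)]) hef
    · have := stacked hi' hlt h.1 h'.2.2 h.2.1
      exact common this.2 hj' (by simp) (by simp) this.1

/-- The straight-line drawing of the double fan. -/
noncomputable def fanDrawing (n : ℕ) : PlaneDrawing (doubleFan n) where
  point i := fanPoint i
  arc := fanArc
  point_injective := fanPoint_injective.comp Fin.val_injective
  isArc _ _ h := isArc_segment fun h' => h.1 (Fin.val_injective (fanPoint_injective h'))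
  mem_of_point_mem_arc _ he _ := mem_of_fanPoint_mem_fanArc he
  arc_inter_arc _ he _ hf hef _ hp := exists_common_end he hf hef hp.1 hp.2

theorem segment_subset_support {n : ℕ} {i j : ℕ} (hi : i < n) (hj : j < n)
    (h : (doubleFan n).Adj ⟨i, hi⟩ ⟨j, hj⟩) :
    segment ℝ (fanPoint i) (fanPoint j) ⊆ (fanDrawing n).support := fun _ hp =>
  .inr (Set.mem_iUnion₂.2 ⟨s(⟨i, hi⟩, ⟨j, hj⟩), h, hp⟩)

/-! ### The faces of the drawing. -/

/-- The ways in which a point can lie on the drawing of the double fan. -/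
theorem mem_support_cases {n : ℕ} (hn : 3 ≤ n) {p : ℝ × ℝ} (hp : p ∈ (fanDrawing n).support) :
    (p.2 = 0 ∧ |p.1| ≤ 1) ∨
    (∃ j : ℕ, 2 ≤ j ∧ j < n ∧ |p.1| ≤ 1 ∧ p.2 = ((j : ℝ) - 1) * (1 - |p.1|)) ∨
    (p.1 = 0 ∧ 1 ≤ p.2 ∧ p.2 ≤ (n : ℝ) - 2) := by
  have arcs : ∀ e ∈ (doubleFan n).edgeSet, p ∈ fanArc e → (p.2 = 0 ∧ |p.1| ≤ 1) ∨
      (∃ j : ℕ, 2 ≤ j ∧ j < n ∧ |p.1| ≤ 1 ∧ p.2 = ((j : ℝ) - 1) * (1 - |p.1|)) ∨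
      (p.1 = 0 ∧ 1 ≤ p.2 ∧ p.2 ≤ (n : ℝ) - 2) := fun e he hp => by
    rcases fanArc_cases he hp with ⟨i, j, rfl, hi, hj, h⟩ | ⟨i, j, rfl, hi, hj, h⟩ |
      ⟨i, j, rfl, hi, hj, h⟩ | ⟨i, j, rfl, hi, hj, h⟩
    · exact .inl h
    · refine .inr (.inl ⟨j, hj, j.2, ?_⟩)
      rw [abs_of_nonpos h.2.1, sub_neg_eq_add]
      exact ⟨by linarith, h.2.2⟩
    · refine .inr (.inl ⟨j, hj, j.2, ?_⟩)
      rw [abs_of_nonneg h.1]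
      exact h.2
    · have h₁ : (2 : ℝ) ≤ i.1 := by exact_mod_cast hi
      have h₂ : (i.1 : ℝ) + 2 ≤ n := by exact_mod_cast (by omega : i.1 + 2 ≤ n)
      exact .inr (.inr ⟨h.1, by linarith, by linarith⟩)
  rcases hp with ⟨w, rfl⟩ | hp
  · by_cases hw : w.1 = 0
    · refine arcs s(w, ⟨1, by omega⟩) ?_ (left_mem_segment _ _ _)
      simp [doubleFan_adj, Fin.ext_iff, hw]
    · refine arcs s(w, ⟨0, by omega⟩) ?_ (left_mem_segment _ _ _)
      simp [doubleFan_adj, Fin.ext_iff, hw]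
  · obtain ⟨e, he, hp⟩ := Set.mem_iUnion₂.1 hp
    exact arcs e he hp

/-- A region cut out by three straight edges is a face bounded by a triangle. -/
theorem isBoundedByTriangle_component {n : ℕ} {i j k : ℕ} (hi : i < n) (hj : j < n) (hk : k < n)
    (hij : (doubleFan n).Adj ⟨i, hi⟩ ⟨j, hj⟩) (hjk : (doubleFan n).Adj ⟨j, hj⟩ ⟨k, hk⟩)
    (hki : (doubleFan n).Adj ⟨k, hk⟩ ⟨i, hi⟩) {U : Set (ℝ × ℝ)} (hU : IsOpen U)
    (hc : IsPreconnected U) (hS : Disjoint U (fanDrawing n).support)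
    (hf : frontier U = segment ℝ (fanPoint i) (fanPoint j) ∪ segment ℝ (fanPoint j) (fanPoint k) ∪
      segment ℝ (fanPoint k) (fanPoint i)) {p : ℝ × ℝ} (hp : p ∈ U) :
    (fanDrawing n).IsBoundedByTriangle
      (connectedComponentIn (fanDrawing n).supportᶜ p) := by
  rw [connectedComponentIn_compl_eq hU hc hS ?_ hp]
  · exact ⟨_, _, _, hij, hjk, hki, hf⟩
  · rw [hf]
    exact Set.union_subset (Set.union_subset (segment_subset_support hi hj hij)
      (segment_subset_support hj hk hjk)) (segment_subset_support hk hi hki)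

theorem orient_hubs (p : ℝ × ℝ) : orient (fanPoint 0) (fanPoint 1) p = 2 * p.2 := by
  simp only [orient, fanPoint_zero, fanPoint_one]; ring

theorem orient_right {j : ℕ} (hj : 2 ≤ j) (p : ℝ × ℝ) :
    orient (fanPoint 1) (fanPoint j) p = ((j : ℝ) - 1) * (1 - p.1) - p.2 := by
  simp only [orient, fanPoint_one, fanPoint_of_two_le hj]; ring

theorem orient_left {j : ℕ} (hj : 2 ≤ j) (p : ℝ × ℝ) :
    orient (fanPoint 0) (fanPoint j) p = p.2 - ((j : ℝ) - 1) * (1 + p.1) := by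
  simp only [orient, fanPoint_zero, fanPoint_of_two_le hj]; ring

theorem orient_axis {i : ℕ} (hi : 2 ≤ i) (p : ℝ × ℝ) :
    orient (fanPoint i) (fanPoint (i + 1)) p = -p.1 := by
  simp only [orient, fanPoint_of_two_le hi, fanPoint_of_two_le (by omega : 2 ≤ i + 1)]
  push_cast; ring

theorem orient_swap (a b p : ℝ × ℝ) : orient b a p = -orient a b p := by
  unfold orient; ring

/-- Reflection in the vertical axis merges the two slanted sides into one condition on `|p.1|`; the
side across the axis from `p` then imposes nothing new. -/
theorem mem_hubTriangle {j : ℕ} (hj : 2 ≤ j) {p : ℝ × ℝ} :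
    p ∈ openTriangle (fanPoint 0) (fanPoint 1) (fanPoint j) ↔
      0 < p.2 ∧ p.2 < ((j : ℝ) - 1) * (1 - |p.1|) := by
  have h1 : (2 : ℝ) ≤ j := by exact_mod_cast hj
  simp only [openTriangle, Set.mem_ofPred_eq, orient_hubs, orient_right hj,
    orient_swap (fanPoint 0) (fanPoint j), orient_left hj]
  rcases abs_cases p.1 with ⟨h, h'⟩ | ⟨h, h'⟩ <;> rw [h] <;> constructor
  · rintro ⟨a, b, c⟩; exact ⟨by linarith, by linarith⟩
  · rintro ⟨a, b⟩; exact ⟨by linarith, by linarith, by nlinarith⟩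
  · rintro ⟨a, b, c⟩; exact ⟨by linarith, by linarith⟩
  · rintro ⟨a, b⟩; exact ⟨by linarith, by nlinarith, by linarith⟩

theorem mem_compl_hubTriangle {j : ℕ} (hj : 2 ≤ j) {p : ℝ × ℝ} :
    p ∈ (closedTriangle (fanPoint 0) (fanPoint 1) (fanPoint j))ᶜ ↔
      p.2 < 0 ∨ ((j : ℝ) - 1) * (1 - |p.1|) < p.2 := by
  have h1 : (2 : ℝ) ≤ j := by exact_mod_cast hj
  rw [← not_iff_not, Set.mem_compl_iff, not_not, not_or, not_lt, not_lt]
  simp only [closedTriangle, Set.mem_ofPred_eq, orient_hubs, orient_right hj,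
    orient_swap (fanPoint 0) (fanPoint j), orient_left hj]
  rcases abs_cases p.1 with ⟨h, h'⟩ | ⟨h, h'⟩ <;> rw [h] <;> constructor
  · rintro ⟨a, b, c⟩; exact ⟨by linarith, by linarith⟩
  · rintro ⟨a, b⟩; exact ⟨by linarith, by linarith, by nlinarith⟩
  · rintro ⟨a, b, c⟩; exact ⟨by linarith, by linarith⟩
  · rintro ⟨a, b⟩; exact ⟨by linarith, by nlinarith, by linarith⟩

theorem mem_leftTriangle {i : ℕ} (hi : 2 ≤ i) {p : ℝ × ℝ} :
    p ∈ openTriangle (fanPoint 0) (fanPoint i) (fanPoint (i + 1)) ↔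
      p.1 < 0 ∧ ((i : ℝ) - 1) * (1 + p.1) < p.2 ∧ p.2 < i * (1 + p.1) := by
  simp only [openTriangle, Set.mem_ofPred_eq, orient_left hi, orient_axis hi,
    orient_swap (fanPoint 0) (fanPoint (i + 1)), orient_left (by omega : 2 ≤ i + 1)]
  push_cast
  constructor
  · rintro ⟨a, b, c⟩; exact ⟨by linarith, by linarith, by linarith⟩
  · rintro ⟨a, b, c⟩; exact ⟨by linarith, by linarith, by linarith⟩

theorem mem_rightTriangle {i : ℕ} (hi : 2 ≤ i) {p : ℝ × ℝ} :
    p ∈ openTriangle (fanPoint 1) (fanPoint (i + 1)) (fanPoint i) ↔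
      0 < p.1 ∧ ((i : ℝ) - 1) * (1 - p.1) < p.2 ∧ p.2 < i * (1 - p.1) := by
  simp only [openTriangle, Set.mem_ofPred_eq, orient_swap (fanPoint i) (fanPoint (i + 1)),
    orient_swap (fanPoint 1) (fanPoint i), orient_right hi, orient_axis hi,
    orient_right (by omega : 2 ≤ i + 1)]
  push_cast
  constructor
  · rintro ⟨a, b, c⟩; exact ⟨by linarith, by linarith, by linarith⟩
  · rintro ⟨a, b, c⟩; exact ⟨by linarith, by linarith, by linarith⟩

/-- Dividing by `w > 0` would place the integer j - 1 strictly between i - 1 and i. It is applied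
with `w` equal to 1 - |p.1|. -/
theorem not_between_levels {i j : ℕ} {w y : ℝ} (h₁ : ((i : ℝ) - 1) * w < y) (h₂ : y < i * w)
    (hy : y = ((j : ℝ) - 1) * w) : False := by
  have hw : 0 < w := by linarith
  subst hy
  have h₁ : (i : ℝ) < j := by
    have := lt_of_mul_lt_mul_right h₁ hw.le
    linarith
  have h₂ : (j : ℝ) < i + 1 := by
    have := lt_of_mul_lt_mul_right h₂ hw.le
    linarith
  have h₁ : i < j := by exact_mod_cast h₁
  have h₂ : j < i + 1 := by exact_mod_cast h₂
  omega

theorem disjoint_lowerFace {n : ℕ} (hn : 3 ≤ n) :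
    Disjoint (openTriangle (fanPoint 0) (fanPoint 1) (fanPoint 2)) (fanDrawing n).support := by
  refine Set.disjoint_left.2 fun p hp hS => ?_
  rw [mem_hubTriangle le_rfl] at hp
  push_cast at hp
  rcases mem_support_cases hn hS with h | ⟨j, hj, -, h, h'⟩ | h
  · linarith
  · have : (2 : ℝ) ≤ j := by exact_mod_cast hj
    nlinarith
  · rw [h.1, abs_zero] at hp
    linarith

theorem disjoint_outerFace {n : ℕ} (hn : 3 ≤ n) :
    Disjoint (closedTriangle (fanPoint 0) (fanPoint 1) (fanPoint (n - 1)))ᶜ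
      (fanDrawing n).support := by
  refine Set.disjoint_left.2 fun p hp hS => ?_
  have hn' : (3 : ℝ) ≤ n := by exact_mod_cast hn
  rw [mem_compl_hubTriangle (by omega), Nat.cast_sub (by omega), Nat.cast_one] at hp
  rcases mem_support_cases hn hS with h | ⟨j, hj, hjn, h, h'⟩ | h
  · rw [h.1] at hp
    rcases hp with hp | hp <;> nlinarith
  · have hj : (2 : ℝ) ≤ j := by exact_mod_cast hj
    have hjn : (j : ℝ) + 1 ≤ n := by exact_mod_cast hjn
    rcases hp with hp | hp <;> nlinarith
  · rw [h.1, abs_zero] at hp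
    rcases hp with hp | hp <;> linarith

theorem disjoint_leftFace {n i : ℕ} (hn : 3 ≤ n) (hi : 2 ≤ i) :
    Disjoint (openTriangle (fanPoint 0) (fanPoint i) (fanPoint (i + 1)))
      (fanDrawing n).support := by
  refine Set.disjoint_left.2 fun p hp hS => ?_
  obtain ⟨h₁, h₂, h₃⟩ := (mem_leftTriangle hi).1 hp
  have hi' : (2 : ℝ) ≤ i := by exact_mod_cast hi
  rcases mem_support_cases hn hS with h | ⟨j, hj, hjn, h, h'⟩ | h
  · nlinarith
  · rw [abs_of_neg h₁, sub_neg_eq_add] at h'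
    exact not_between_levels h₂ h₃ h'
  · linarith

theorem disjoint_rightFace {n i : ℕ} (hn : 3 ≤ n) (hi : 2 ≤ i) :
    Disjoint (openTriangle (fanPoint 1) (fanPoint (i + 1)) (fanPoint i))
      (fanDrawing n).support := by
  refine Set.disjoint_left.2 fun p hp hS => ?_
  obtain ⟨h₁, h₂, h₃⟩ := (mem_rightTriangle hi).1 hp
  have hi' : (2 : ℝ) ≤ i := by exact_mod_cast hi
  rcases mem_support_cases hn hS with h | ⟨j, hj, hjn, h, h'⟩ | h
  · nlinarith
  · rw [abs_of_pos h₁] at h'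
    exact not_between_levels h₂ h₃ h'
  · linarith

/-- Every point off the drawing lies in one of the regions cut out by three straight edges. -/
theorem mem_region_of_notMem_support {n : ℕ} (hn : 3 ≤ n) {p : ℝ × ℝ}
    (hp : p ∉ (fanDrawing n).support) :
    p ∈ openTriangle (fanPoint 0) (fanPoint 1) (fanPoint 2) ∨
    p ∈ (closedTriangle (fanPoint 0) (fanPoint 1) (fanPoint (n - 1)))ᶜ ∨
    ∃ i, 2 ≤ i ∧ i + 1 < n ∧
      (p ∈ openTriangle (fanPoint 0) (fanPoint i) (fanPoint (i + 1)) ∨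
        p ∈ openTriangle (fanPoint 1) (fanPoint (i + 1)) (fanPoint i)) := by
  have hn' : (3 : ℝ) ≤ n := by exact_mod_cast hn
  by_cases hout : p ∈ (closedTriangle (fanPoint 0) (fanPoint 1) (fanPoint (n - 1)))ᶜ
  · exact .inr (.inl hout)
  have hbounds := hout
  rw [mem_compl_hubTriangle (by omega), not_or, not_lt, not_lt, Nat.cast_sub (by omega),
    Nat.cast_one] at hbounds
  obtain ⟨hy, hle⟩ := hbounds
  have hx : |p.1| ≤ 1 := by nlinarith
  have hy : 0 < p.2 := hy.lt_of_ne' fun h0 => hp <|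
    segment_subset_support (by omega) (by omega) (by simp [doubleFan_adj])
      (mem_segment_hubs.2 ⟨h0, hx⟩)
  have hw : 0 < 1 - |p.1| := by nlinarith
  by_cases hlow : p ∈ openTriangle (fanPoint 0) (fanPoint 1) (fanPoint 2)
  · exact .inl hlow
  rw [mem_hubTriangle le_rfl, not_and, not_lt] at hlow
  have hlow := hlow hy
  push_cast at hlow
  -- The quotient is the level of `p`: it equals j - 1 on the hub edges to path vertex `j`. Its
  -- floor `k` therefore locates `p` between the edges to k + 1 and k + 2.
  have ht : 1 ≤ p.2 / (1 - |p.1|) := by rw [le_div_iff₀ hw]; linarith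
  have ht' : p.2 / (1 - |p.1|) ≤ (n : ℝ) - 2 := by rw [div_le_iff₀ hw]; linarith
  obtain ⟨k, hk⟩ : ∃ k, k = ⌊p.2 / (1 - |p.1|)⌋₊ := ⟨_, rfl⟩
  have hk1 : 1 ≤ k := by rw [hk]; exact Nat.le_floor (by exact_mod_cast ht)
  have hkle : (k : ℝ) ≤ p.2 / (1 - |p.1|) := by rw [hk]; exact Nat.floor_le (by linarith)
  have hklt : p.2 / (1 - |p.1|) < k + 1 := by rw [hk]; exact Nat.lt_floor_add_one _
  have hkn : k + 2 ≤ n := by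
    have : (k : ℝ) + 2 ≤ n := by linarith
    exact_mod_cast this
  rw [le_div_iff₀ hw] at hkle
  rw [div_lt_iff₀ hw] at hklt
  -- At an exactly integral level, `p` would lie on the edge to k + 1 from the hub on its side.
  have hne : k * (1 - |p.1|) ≠ p.2 := fun heq => hp <| by
    rcases le_total p.1 0 with hneg | hpos
    · rw [abs_of_nonpos hneg] at heq hx
      refine segment_subset_support (i := 0) (j := k + 1) (by omega) (by omega)
        (by simp [doubleFan_adj]) ((mem_segment_left (by omega)).2 ?_)
      push_cast
      exact ⟨by linarith, hneg, by linarith⟩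
    · rw [abs_of_nonneg hpos] at heq hx
      refine segment_subset_support (i := 1) (j := k + 1) (by omega) (by omega)
        (by simp [doubleFan_adj, Fin.ext_iff]; omega) ((mem_segment_right (by omega)).2 ?_)
      push_cast
      exact ⟨hpos, hx, by linarith⟩
  -- If k + 2 = n, the bound from the outer triangle would force the level to be exactly `k`.
  have hkn' : k + 2 < n := hkn.lt_of_ne fun heq => hne <| le_antisymm hkle <| by
    rw [← heq] at hle
    push_cast at hle
    linarith
  refine .inr (.inr ⟨k + 1, by omega, by omega, ?_⟩)
  rw [mem_leftTriangle (by omega), mem_rightTriangle (by omega)]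
  push_cast
  have hlt := hkle.lt_of_ne hne
  rcases lt_trichotomy p.1 0 with h | h | h
  · rw [abs_of_neg h] at hlt hklt
    exact .inl ⟨h, by linarith, by linarith⟩
  · rw [h, abs_zero] at hlt hklt
    exact absurd (segment_subset_support (i := k + 1) (j := k + 1 + 1) (by omega) (by omega)
      (by simp [doubleFan_adj]) ((mem_segment_axis (by omega)).2
        ⟨h, by push_cast; linarith, by push_cast; linarith⟩)) hp
  · rw [abs_of_pos h] at hlt hklt
    exact .inr ⟨h, by linarith, by linarith⟩

theorem orient_hubs_pos {j : ℕ} (hj : 2 ≤ j) :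
    0 < orient (fanPoint 0) (fanPoint 1) (fanPoint j) := by
  have : (2 : ℝ) ≤ j := by exact_mod_cast hj
  rw [orient_hubs, fanPoint_of_two_le hj]
  simp only
  linarith

theorem isPlaneTriangulation_doubleFan {n : ℕ} (hn : 3 ≤ n) :
    IsPlaneTriangulation (doubleFan n) := by
  refine ⟨fanDrawing n, ?_⟩
  rintro _ ⟨p, hp, rfl⟩
  rcases mem_region_of_notMem_support hn hp with h | h | ⟨i, hi, hin, h | h⟩
  · refine isBoundedByTriangle_component (i := 0) (j := 1) (k := 2) (by omega) (by omega) (by omega)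
      ?_ ?_ ?_ (isOpen_openTriangle _ _ _) (convex_openTriangle _ _ _).isPreconnected
      (disjoint_lowerFace hn) (frontier_openTriangle (orient_hubs_pos le_rfl)) h <;>
    simp [doubleFan_adj]
  · refine isBoundedByTriangle_component (i := 0) (j := 1) (k := n - 1) (by omega) (by omega)
      (by omega) ?_ ?_ ?_ (isClosed_closedTriangle _ _ _).isOpen_compl
      (isPreconnected_compl_closedTriangle (orient_hubs_pos (by omega)))
      (disjoint_outerFace hn) (frontier_compl_closedTriangle (orient_hubs_pos (by omega))) h <;>
    simp [doubleFan_adj, Fin.ext_iff] <;> omega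
  · have hpos : 0 < orient (fanPoint 0) (fanPoint i) (fanPoint (i + 1)) := by
      rw [orient_left hi, fanPoint_of_two_le (by omega)]
      push_cast
      linarith
    refine isBoundedByTriangle_component (i := 0) (j := i) (k := i + 1) (by omega) (by omega)
      (by omega) ?_ ?_ ?_ (isOpen_openTriangle _ _ _) (convex_openTriangle _ _ _).isPreconnected
      (disjoint_leftFace hn hi) (frontier_openTriangle hpos) h <;>
    simp [doubleFan_adj, Fin.ext_iff]
    omega
  · have hpos : 0 < orient (fanPoint 1) (fanPoint (i + 1)) (fanPoint i) := by
      rw [orient_right (by omega), fanPoint_of_two_le hi]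
      push_cast
      linarith
    refine isBoundedByTriangle_component (i := 1) (j := i + 1) (k := i) (by omega) (by omega)
      (by omega) ?_ ?_ ?_ (isOpen_openTriangle _ _ _) (convex_openTriangle _ _ _).isPreconnected
      (disjoint_rightFace hn hi) (frontier_openTriangle hpos) h <;>
    simp [doubleFan_adj, Fin.ext_iff] <;> omega

/-- Consecutive labels are always adjacent, so 0, 1, …, k-1 is itself a path. -/
theorem pathGraph_isContained_doubleFan {k n : ℕ} (hkn : k ≤ n) :
    (SimpleGraph.pathGraph k).IsContained (doubleFan n) := by
  refine ⟨⟨⟨Fin.castLE hkn, fun {i j} h => ?_⟩, Fin.castLE_injective hkn⟩⟩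
  rw [SimpleGraph.pathGraph_adj] at h
  simp only [doubleFan_adj, ne_eq, Fin.ext_iff, Fin.val_castLE]
  omega

/-! ### The coloring and its palette. -/

/-- The edges off the vertex `0` that get a color of their own: they form a matching, except
that the edges ending in `m - 1` are kept as well. -/
def Linked (m i j : ℕ) : Prop :=
  (j = i + 1 ∧ (i % 2 = 1 ∨ i + 2 = m)) ∨ (i = j + 1 ∧ (j % 2 = 1 ∨ j + 2 = m))

open Classical in
/-- The edges at `0` and the linked pairs get different positive colors, all other edges get `0`. -/
noncomputable def fanColor (n m i j : ℕ) : ℕ :=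
  -- Halving the odd lower ends 1, 3, 5, … gives 0, 1, 2, …; when m = n is even, the extra edge has
  -- lower end n - 2 and yields the next value.
  if min i j = 0 then max i j else if Linked m i j then n + min i j / 2 else 0

theorem fanColor_comm (n m i j : ℕ) : fanColor n m i j = fanColor n m j i := by
  unfold fanColor
  rw [min_comm, max_comm, show Linked m i j ↔ Linked m j i from or_comm]

theorem linked_of_fanColor_ne_zero {n m i j : ℕ} (hi : i ≠ 0) (hj : j ≠ 0)
    (h : fanColor n m i j ≠ 0) : Linked m i j := by
  unfold fanColor at h
  rw [if_neg (by omega)] at h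
  by_contra hl
  exact h (if_neg hl)

/-- The coloring of the edges of the double fan given by `fanColor`. -/
noncomputable def fanColoring (n m : ℕ) (e : (doubleFan n).edgeSet) : ℕ :=
  Sym2.lift ⟨fun i j : Fin n => fanColor n m i j, fun _ _ => fanColor_comm n m _ _⟩ e.1

theorem fanColor_mem_range {n m i j : ℕ} (hij : i < j) (hj : j < n) (h : i ≤ 1 ∨ i + 1 = j) :
    fanColor n m i j ∈ Set.range (fanColoring n m) :=
  ⟨⟨s(⟨i, hij.trans hj⟩, ⟨j, hj⟩), ⟨fun h' => hij.ne (congrArg Fin.val h'), by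
    simp only; omega⟩⟩, rfl⟩

theorem mem_range_fanColoring {n m x : ℕ} (hn : 4 ≤ n)
    (hx : x < n + (n - 1) / 2 ∨ m = n ∧ x < n + n / 2) : x ∈ Set.range (fanColoring n m) := by
  rcases Nat.eq_zero_or_pos x with rfl | hpos
  -- Color 0 occurs on the edge 13, whose ends are not consecutive; this is where `4 ≤ n` is needed.
  · have : fanColor n m 1 3 = 0 := by
      unfold fanColor Linked
      rw [if_neg (by simp), if_neg (by omega)]
    exact this ▸ fanColor_mem_range (by omega) (by omega) (.inl le_rfl)
  rcases Nat.lt_or_ge x n with hxn | hxn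
  · have : fanColor n m 0 x = x := by simp [fanColor]
    have := this ▸ fanColor_mem_range (n := n) (m := m) hpos hxn (.inl (Nat.zero_le 1))
    exact this
  obtain ⟨t, rfl⟩ := Nat.exists_eq_add_of_le hxn
  have own : ∀ i, 1 ≤ i → i + 1 < n → i / 2 = t → (i % 2 = 1 ∨ i + 2 = m) →
      n + t ∈ Set.range (fanColoring n m) := fun i h1 hi hit hl => by
    have : fanColor n m i (i + 1) = n + t := by
      unfold fanColor
      rw [if_neg (by omega), if_pos (.inl ⟨rfl, hl⟩), ← hit, min_eq_left (by omega)]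
    exact this ▸ fanColor_mem_range (by omega) hi (.inr rfl)
  rcases Nat.lt_or_ge t ((n - 1) / 2) with ht | ht
  · exact own (2 * t + 1) (by omega) (by omega) (by omega) (.inl (by omega))
  -- Only even n with m = n and t = (n - 2) / 2 reaches this case: the extra edge.
  · exact own (n - 2) (by omega) (by omega) (by omega) (.inr (by omega))

/-! ### Excluding rainbow paths. -/

/-- The vertices of a rainbow path: removing one position `z` (that of vertex `0`) and one step `w`
(that of color `0`) leaves linked pairs only. -/
theorem exists_linked_of_hasRainbowCopy {n m k : ℕ} (hk : 0 < k)
    (h : HasRainbowCopy (SimpleGraph.pathGraph k) (fanColoring n m)) :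
    ∃ (v : ℕ → ℕ) (z w : ℕ), (∀ i < k, ∀ j < k, v i = v j → i = j) ∧ (∀ i, v i < n) ∧
      (∀ i, i + 1 < k → i ≠ z → i + 1 ≠ z → i ≠ w → Linked m (v i) (v (i + 1))) := by
  obtain ⟨φ, hφ⟩ := h
  have : NeZero k := ⟨hk.ne'⟩
  let v : ℕ → ℕ := fun i => (φ (Fin.ofNat k i)).1
  have hinj : ∀ i < k, ∀ j < k, v i = v j → i = j := fun i hi j hj hij => by
    have := congrArg Fin.val (φ.injective (Fin.ext hij))
    simpa [Nat.mod_eq_of_lt hi, Nat.mod_eq_of_lt hj] using this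
  have hadj : ∀ i, i + 1 < k →
      (SimpleGraph.pathGraph k).Adj (Fin.ofNat k i) (Fin.ofNat k (i + 1)) := fun i hi => by
    rw [SimpleGraph.pathGraph_adj]
    simp [Nat.mod_eq_of_lt hi, Nat.mod_eq_of_lt (Nat.lt_of_succ_lt hi)]
  have hone : ∀ i j, i + 1 < k → j + 1 < k → fanColor n m (v i) (v (i + 1)) = 0 →
      fanColor n m (v j) (v (j + 1)) = 0 → i = j := fun i j hi hj h0 h0' => by
    have heq := @hφ ⟨s(Fin.ofNat k i, Fin.ofNat k (i + 1)), hadj i hi⟩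
      ⟨s(Fin.ofNat k j, Fin.ofNat k (j + 1)), hadj j hj⟩ (h0.trans h0'.symm)
    have heq := congrArg Subtype.val heq
    simp only [Sym2.eq_iff, Fin.ext_iff, Fin.val_ofNat, Nat.mod_eq_of_lt hi, Nat.mod_eq_of_lt hj,
      Nat.mod_eq_of_lt (Nat.lt_of_succ_lt hi), Nat.mod_eq_of_lt (Nat.lt_of_succ_lt hj)] at heq
    omega
  obtain ⟨z, hz⟩ : ∃ z, ∀ i < k, i ≠ z → v i ≠ 0 := by
    by_cases hex : ∃ z < k, v z = 0
    · obtain ⟨z, hz, hvz⟩ := hex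
      exact ⟨z, fun i hi hiz h0 => hiz (hinj i hi z hz (h0.trans hvz.symm))⟩
    -- When the path misses vertex 0, any position serves as `z`, since discarding one only weakens
    -- the claim. The same default is used for `w`.
    · exact ⟨0, fun i hi _ h0 => hex ⟨i, hi, h0⟩⟩
  obtain ⟨w, hw⟩ : ∃ w, ∀ i, i + 1 < k → i ≠ w → fanColor n m (v i) (v (i + 1)) ≠ 0 := by
    by_cases hex : ∃ w, w + 1 < k ∧ fanColor n m (v w) (v (w + 1)) = 0
    · obtain ⟨w, hw, hcw⟩ := hex
      exact ⟨w, fun i hi hiw h0 => hiw (hone i w hi hw h0 hcw)⟩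
    · exact ⟨0, fun i hi _ h0 => hex ⟨i, hi, h0⟩⟩
  exact ⟨v, z, w, hinj, fun i => (φ _).2, fun i hi h1 h2 h3 => linked_of_fanColor_ne_zero
    (hz i (by omega) h1) (hz (i + 1) hi h2) (hw i hi h3)⟩

/-- Three successively linked vertices are the last three vertices. -/
theorem linked_linked {n m a b c : ℕ} (hm : m = 0 ∨ m = n) (ha : a < n) (hb : b < n) (hc : c < n)
    (hac : a ≠ c) (h₁ : Linked m a b) (h₂ : Linked m b c) :
    m = n ∧ n ≤ a + 3 ∧ n ≤ b + 3 ∧ n ≤ c + 3 := by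
  unfold Linked at h₁ h₂
  omega

/-- With m = 0 the linked pairs form a matching, so it suffices to find three consecutive positions
untouched by `z` and `w`. -/
theorem not_hasRainbowCopy_pathGraph_eight (n : ℕ) :
    ¬ HasRainbowCopy (SimpleGraph.pathGraph 8) (fanColoring n 0) := by
  intro h
  obtain ⟨v, z, w, hinj, hlt, hl⟩ := exists_linked_of_hasRainbowCopy (by norm_num) h
  obtain ⟨i, hi, hz, hw⟩ : ∃ i < 6, (z < i ∨ i + 2 < z) ∧ (w < i ∨ i + 1 < w) := by
    by_contra! hcon
    have h0 := hcon 0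
    have h1 := hcon 1
    have h2 := hcon 2
    have h3 := hcon 3
    have h4 := hcon 4
    have h5 := hcon 5
    omega
  have := linked_linked (.inl rfl) (hlt i) (hlt (i + 1)) (hlt (i + 2))
    (fun h => by have := hinj i (by omega) (i + 2) (by omega) h; omega)
    (hl i (by omega) (by omega) (by omega) (by omega))
    (hl (i + 1) (by omega) (by omega) (by omega) (by omega))
  have := hlt i
  omega

/-- At least eight positions in at most three pieces contain two different windows of three
consecutive positions. Both windows must map into the last three vertices, yet together they occupy
at least four positions. -/
theorem not_hasRainbowCopy_pathGraph_nine (n : ℕ) :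
    ¬ HasRainbowCopy (SimpleGraph.pathGraph 9) (fanColoring n n) := by
  intro h
  obtain ⟨v, z, w, hinj, hlt, hl⟩ := exists_linked_of_hasRainbowCopy (by norm_num) h
  obtain ⟨i, j, hij, hj, hz, hw, hz', hw'⟩ : ∃ i j, i < j ∧ j < 7 ∧ (z < i ∨ i + 2 < z) ∧
      (w < i ∨ i + 1 < w) ∧ (z < j ∨ j + 2 < z) ∧ (w < j ∨ j + 1 < w) := by
    rcases (by omega : z ≤ 2 ∨ z = 3 ∨ z = 4 ∨ z = 5 ∨ 6 ≤ z) with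
      h | h | h | h | h <;>
    rcases (by omega : w ≤ 1 ∨ w = 2 ∨ w = 3 ∨ w = 4 ∨ w = 5 ∨ 6 ≤ w) with
      h' | h' | h' | h' | h' | h' <;>
    first
    | exact ⟨0, 1, by omega⟩
    | exact ⟨0, 3, by omega⟩
    | exact ⟨0, 4, by omega⟩
    | exact ⟨0, 6, by omega⟩
    | exact ⟨2, 3, by omega⟩
    | exact ⟨2, 6, by omega⟩
    | exact ⟨3, 4, by omega⟩
    | exact ⟨3, 6, by omega⟩
    | exact ⟨5, 6, by omega⟩
  have last : ∀ i < 7, (z < i ∨ i + 2 < z) → (w < i ∨ i + 1 < w) →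
      n ≤ v i + 3 ∧ n ≤ v (i + 1) + 3 ∧ n ≤ v (i + 2) + 3 := fun i hi hz hw =>
    (linked_linked (.inr rfl) (hlt i) (hlt (i + 1)) (hlt (i + 2))
      (fun h => by have := hinj i (by omega) (i + 2) (by omega) h; omega)
      (hl i (by omega) (by omega) (by omega) (by omega))
      (hl (i + 1) (by omega) (by omega) (by omega) (by omega))).2
  have hi := last i (by omega) hz hw
  have hj := last j hj hz' hw'
  -- The first window and the last position of the second give four distinct vertices among n-3,
  -- n-2, n-1.
  have n1 := fun h => hinj i (by omega) (i + 1) (by omega) h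
  have n2 := fun h => hinj i (by omega) (i + 2) (by omega) h
  have n3 := fun h => hinj (i + 1) (by omega) (i + 2) (by omega) h
  have n4 := fun h => hinj i (by omega) (j + 2) (by omega) h
  have n5 := fun h => hinj (i + 1) (by omega) (j + 2) (by omega) h
  have n6 := fun h => hinj (i + 2) (by omega) (j + 2) (by omega) h
  have l1 := hlt i
  have l2 := hlt (i + 1)
  have l3 := hlt (i + 2)
  have l4 := hlt (j + 2)
  omega

/-! ### The lower bound. -/

theorem le_planarAntiRamsey_pathGraph {n m k M : ℕ} (hkn : k ≤ n) (hn : 4 ≤ n)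
    (hc : ¬ HasRainbowCopy (SimpleGraph.pathGraph k) (fanColoring n m))
    (hM : ∀ x < M, x ∈ Set.range (fanColoring n m)) :
    M ≤ planarAntiRamsey n (SimpleGraph.pathGraph k) := by
  refine le_trans ?_ (le_csSup (colorCounts_bddAbove n _) ⟨doubleFan n,
    isPlaneTriangulation_doubleFan (by omega), pathGraph_isContained_doubleFan hkn,
    fanColoring n m, hc, rfl⟩)
  calc M = (Set.Iio M).ncard := by simp [Set.ncard_eq_toFinset_card']
    _ ≤ _ := Set.ncard_le_ncard hM (Set.finite_range _)

end PlanarAntiRamsey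

theorem theorem2p2 (k : ℕ) (hk : k = 8 ∨ k = 9) (n : ℕ) (hn : k ≤ n)
    (ε ε' : ℕ) (hε : ε = k % 2) (hε' : ε' = (n + 1 + ε) % 2) :
    (3 * (n : ℝ) + 3 * (ε : ℝ) - (ε' : ℝ) - 3) / 2 ≤
      (PlanarAntiRamsey.planarAntiRamsey n (SimpleGraph.pathGraph k) : ℝ) := by
  suffices h : 3 * n + 3 * ε ≤
      2 * PlanarAntiRamsey.planarAntiRamsey n (SimpleGraph.pathGraph k) + ε' + 3 by
    have : (3 * n + 3 * ε : ℝ) ≤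
        2 * PlanarAntiRamsey.planarAntiRamsey n (SimpleGraph.pathGraph k) + ε' + 3 := by
      exact_mod_cast h
    linarith
  rcases hk with rfl | rfl
  -- For k = 8 this palette has one color more than required; for k = 9 the count below is exactly
  -- the required one.
  · have := PlanarAntiRamsey.le_planarAntiRamsey_pathGraph (M := n + (n - 1) / 2) hn (by omega)
      (PlanarAntiRamsey.not_hasRainbowCopy_pathGraph_eight n)
      fun x hx => PlanarAntiRamsey.mem_range_fanColoring (by omega) (.inl hx)
    omega
  · have := PlanarAntiRamsey.le_planarAntiRamsey_pathGraph (M := n + n / 2) hn (by omega)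
      (PlanarAntiRamsey.not_hasRainbowCopy_pathGraph_nine n)
      fun x hx => PlanarAntiRamsey.mem_range_fanColoring (by omega) (.inr ⟨rfl, hx⟩)
    omega
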